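/- Let $\mathcal{C}_n=\{0,1\}^n$ carry componentwise addition modulo $2$ and the Hamming distance; the weight of a word is its number of nonzero entries. For a set $P$ of natural numbers, a $P$-isometry is a bijection $\phi:\mathcal{C}_n\to\mathcal{C}_n$ such that $d(\phi(x),\phi(y))=p$ whenever $d(x,y)=p\in P$; an isometry is a bijection preserving all Hamming distances. Let $T_a$ be the translation $c\mapsto c+a$, and let $\overline{1}^j$ be the word with $0$ in position $j$ and $1$ in every other position. Given positions $i,j\in\{1,\dots,n\}$ (possibly equal) and a bijection $\sigma:\{1,\dots,n\}\setminus\{i\}\to\{1,\dots,n\}\setminus\{j\}$, the associated $\sigma_{ij}$-mapping $\tau:\mathcal{C}_n\to\mathcal{C}_n$ sends $c$ to the word $d$ with $d_k=c_{\sigma^{-1}(k)}$ for $k\ne j$ and $d_j=0$ if $c_i=0$, and with $d_k=c_{\sigma^{-1}(k)}+1$ for $k\neq j$ and $d_j=1$ if $c_i=1$. If $n\equiv 1\pmod 4$, then every $\{\frac{n-1}{2},\frac{n+1}{2},n\}$-isometry $\phi$ of $\mathcal{C}_n$ with $\phi(\overline{0})=\overline{0}$ is an isometry. If $n\equiv 3\pmod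 4$, then for every $\{\frac{n-1}{2},\frac{n+1}{2},n\}$-isometry $\phi$ of $\mathcal{C}_n$ with $\phi(\overline{0})=\overline{0}$ that is not an isometry, there are positions $i,j$ and a $\sigma_{ij}$-mapping $\tau$ such that $\phi(c)=\tau(c)$ for all words $c$ of even weight and $\phi(c)=T_{\overline{1}^j}(\tau(c))$ for all words $c$ of odd weight. Conversely, for all positions $i,j$ and every $\sigma_{ij}$-mapping $\tau$, the map so defined is an $\{\frac{n-1}{2},\frac{n+1}{2},n\}$-isometry fixing $\overline{0}$. -/

import Mathlib

/-- The words of length `n`: the Boolean cube `{0,1}^n` with componentwise addition modulo 2.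
Distances are Hamming distances `hammingDist`, weights are Hamming norms `hammingNorm`. -/
abbrev Word (n : ℕ) : Type := Fin n → ZMod 2

/-- A `P`-isometry of the Boolean cube: a bijection preserving every Hamming distance in `P`. -/
def IsWeakIsometry {n : ℕ} (P : Set ℕ) (φ : Word n → Word n) : Prop :=
  Function.Bijective φ ∧
    ∀ p ∈ P, ∀ x y : Word n, hammingDist x y = p → hammingDist (φ x) (φ y) = p

/-- An isometry of the Boolean cube: a bijection preserving all Hamming distances. -/
def IsCubeIsometry {n : ℕ} (φ : Word n → Word n) : Prop :=
  Function.Bijective φ ∧ ∀ x y : Word n, hammingDist (φ x) (φ y) = hammingDist x y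

/-- The translation `c ↦ c + a`. -/
def translation {n : ℕ} (a : Word n) : Word n → Word n := fun c => c + a

/-- The word with entry `0` in position `j` and entry `1` in all other positions. -/
def onesExcept {n : ℕ} (j : Fin n) : Word n := fun k => if k = j then 0 else 1

/-- `τ` is the mapping of the cube attached to positions `i`, `j` and a bijection `σ` from the
positions other than `i` to the positions other than `j`. -/
def IsSigmaMappingOf {n : ℕ} (i j : Fin n) (σ : {k : Fin n // k ≠ i} ≃ {k : Fin n // k ≠ j})
    (τ : Word n → Word n) : Prop :=
  ∀ c : Word n,
    (c i = 0 → (∀ k : {k : Fin n // k ≠ j}, τ c k = c (σ.symm k)) ∧ τ c j = 0) ∧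
    (c i = 1 → (∀ k : {k : Fin n // k ≠ j}, τ c k = c (σ.symm k) + 1) ∧ τ c j = 1)

/-- `τ` is a `σ_{i,j}`-mapping, for some bijection `σ`. -/
def IsSigmaMapping {n : ℕ} (i j : Fin n) (τ : Word n → Word n) : Prop :=
  ∃ σ : {k : Fin n // k ≠ i} ≃ {k : Fin n // k ≠ j}, IsSigmaMappingOf i j σ τ

/-- `φ` equals a `σ_{i,j}`-mapping `τ` on the words of even weight, and `τ` followed by the
translation by `onesExcept j` on the words of odd weight. -/
def IsTwistedSigmaMapping {n : ℕ} (φ : Word n → Word n) : Prop :=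
  ∃ (i j : Fin n) (τ : Word n → Word n), IsSigmaMapping i j τ ∧
    (∀ c : Word n, Even (hammingNorm c) → φ c = τ c) ∧
    (∀ c : Word n, Odd (hammingNorm c) → φ c = (translation (onesExcept j) ∘ τ) c)

/-!
Write `n = 2 * m + 1`. Word pairs at even distance `2 * a` have
`choose (2 * a) a * choose (n - 2 * a) (m - a)` common words at distance `m`, which is half of the
product of the central binomial coefficients of `a` and `m + 1 - a`; this determines the unordered
pair `{a, m + 1 - a}`. So a bijection that preserves the distance `m` preserves even distances up to
`d ↔ n + 1 - d`, that is, as distances in the folded cube, the `(n + 1)`-cube modulo complements.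

If `m` is even, then `m` and `m + 2` are such a pair of distances, so `m + 2` is preserved too.
Counting words at distances `m` and `m + 2` tells the distances `2` and `n - 1` apart, and the
latter corresponds to the distance `1` by complementing a word.

If `m` is odd and `7 ≤ n`, the words at folded distance `2` from `0` are the two-element sets of the
`n + 1` positions of the folded cube, and their incidences are preserved. By Whitney's argument on
line graphs they are permuted by some `π` acting on positions. For an even word `x`, its folded
distance to the word of a pair `{p, q}` tells whether `x` has equal letters in `p` and `q`, so `π`
determines the mapping on all even words. It is an isometry if `π` fixes the extra position, and is
given by a `σ_{i,j}`-mapping otherwise.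
-/

open Finset Function
open scoped symmDiff

theorem centralBinom_succ_mul_lt {a b : ℕ} (hab : a < b) :
    (a + 1).centralBinom * b.centralBinom < a.centralBinom * (b + 1).centralBinom := by
  have hpos : 0 < a.centralBinom * b.centralBinom :=
    Nat.mul_pos a.centralBinom_pos b.centralBinom_pos
  refine Nat.lt_of_mul_lt_mul_left (a := (a + 1) * (b + 1)) ?_
  calc (a + 1) * (b + 1) * ((a + 1).centralBinom * b.centralBinom)
      = (b + 1) * ((a + 1) * (a + 1).centralBinom) * b.centralBinom := by ring
    _ = (b + 1) * (2 * (2 * a + 1)) * (a.centralBinom * b.centralBinom) := by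
      rw [Nat.succ_mul_centralBinom_succ]; ring
    _ < (a + 1) * (2 * (2 * b + 1)) * (a.centralBinom * b.centralBinom) := by
      gcongr ?_ * _
      nlinarith
    _ = (a + 1) * ((b + 1) * (b + 1).centralBinom) * a.centralBinom := by
      rw [Nat.succ_mul_centralBinom_succ]; ring
    _ = (a + 1) * (b + 1) * (a.centralBinom * (b + 1).centralBinom) := by ring

theorem centralBinom_mul_lt_of_lt {a b c d : ℕ} (hac : a < c) (hcd : c ≤ d)
    (hsum : a + b = c + d) :
    c.centralBinom * d.centralBinom < a.centralBinom * b.centralBinom := by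
  induction c, hac using Nat.le_induction generalizing d with
  | base =>
    obtain rfl : b = d + 1 := by omega
    exact centralBinom_succ_mul_lt (by omega)
  | succ c _ ih => exact (centralBinom_succ_mul_lt (by omega)).trans (ih (by omega) (by omega))

theorem eq_or_eq_of_centralBinom_mul_eq {a b c d : ℕ} (hsum : a + b = c + d)
    (h : a.centralBinom * b.centralBinom = c.centralBinom * d.centralBinom) : a = c ∨ a = d := by
  wlog hab : a ≤ b generalizing a b
  · have := this (a := b) (b := a) (by omega) (by rw [mul_comm, h]) (by omega)
    omega
  wlog hcd : c ≤ d generalizing c d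
  · exact (this (c := d) (d := c) (by omega) (by rw [h, mul_comm]) (by omega)).symm
  rcases lt_trichotomy a c with hac | hac | hca
  · exact absurd h (centralBinom_mul_lt_of_lt hac hcd hsum).ne'
  · exact Or.inl hac
  · exact absurd h (centralBinom_mul_lt_of_lt hca hab hsum.symm).ne

theorem centralBinom_succ_eq_two_mul_choose (b : ℕ) :
    (b + 1).centralBinom = 2 * (2 * b + 1).choose b := by
  rw [Nat.centralBinom_eq_two_mul_choose, show 2 * (b + 1) = 2 * b + 1 + 1 by ring,
    Nat.choose_succ_succ, Nat.choose_symm_half]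
  ring

section SetFamilies

variable {α : Type*} [DecidableEq α]

theorem card_symmDiff_add_two_mul_card_inter (S T : Finset α) :
    #(S ∆ T) + 2 * #(S ∩ T) = #S + #T := by
  have hcard : #(S ∆ T) = #(S \ T) + #(T \ S) := by
    rw [symmDiff_def]
    exact card_union_of_disjoint disjoint_sdiff_sdiff
  have hS := card_inter_add_card_sdiff S T
  have hT := card_inter_add_card_sdiff T S
  rw [inter_comm] at hT
  omega

theorem card_filter_card_inter_card_sdiff [Fintype α] (D : Finset α) (a b : ℕ) :
    #{S : Finset α | #(S ∩ D) = a ∧ #(S \ D) = b} =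
      (#D).choose a * (Fintype.card α - #D).choose b := by
  rw [← card_compl, ← card_powersetCard, ← card_powersetCard b, ← card_product]
  refine card_nbij' (fun S => (S ∩ D, S \ D)) (fun p => p.1 ∪ p.2) ?_ ?_ ?_ ?_
  · intro S
    simp only [coe_filter, mem_univ, true_and, Set.mem_ofPred_eq, mem_coe, mem_product,
      mem_powersetCard, subset_compl_iff_disjoint_right]
    exact fun h => ⟨⟨inter_subset_right, h.1⟩, sdiff_disjoint, h.2⟩
  · rintro ⟨A, B⟩ hAB
    simp only [mem_coe, mem_product, mem_powersetCard, subset_compl_iff_disjoint_right] at hAB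
    simp [union_inter_distrib_right, union_sdiff_distrib, inter_eq_left.2 hAB.1.1,
      disjoint_iff_inter_eq_empty.1 hAB.2.1, sdiff_eq_empty_iff_subset.2 hAB.1.1,
      sdiff_eq_self_of_disjoint hAB.2.1, hAB.1.2, hAB.2.2]
  · intro S _
    exact sup_inf_sdiff S D
  · rintro ⟨A, B⟩ hAB
    simp only [mem_coe, mem_product, mem_powersetCard, subset_compl_iff_disjoint_right] at hAB
    simp [union_inter_distrib_right, union_sdiff_distrib, inter_eq_left.2 hAB.1.1,
      disjoint_iff_inter_eq_empty.1 hAB.2.1, sdiff_eq_empty_iff_subset.2 hAB.1.1,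
      sdiff_eq_self_of_disjoint hAB.2.1]

theorem exists_forall_mem_of_intersecting {𝒜 : Finset (Finset α)}
    (htwo : ∀ A ∈ 𝒜, #A = 2) (hinter : (𝒜 : Set (Finset α)).Intersecting) (hcard : 4 ≤ #𝒜) :
    ∃ x, ∀ A ∈ 𝒜, x ∈ A := by
  by_contra! hstar
  have hmeet : ∀ A ∈ 𝒜, ∀ B ∈ 𝒜, ∃ x ∈ A, x ∈ B := fun A hA B hB =>
    not_disjoint_iff.1 (hinter hA hB)
  obtain ⟨A, hA⟩ := card_pos.1 (by omega : 0 < #𝒜)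
  obtain ⟨x, y, hxy, rfl⟩ := card_eq_two.1 (htwo A hA)
  obtain ⟨B, hB, hxB⟩ := hstar x
  obtain ⟨C, hC, hyC⟩ := hstar y
  obtain ⟨z, hzB, hzC⟩ := hmeet B hB C hC
  have hyB : y ∈ B := by have := hmeet _ hA B hB; grind
  have hxC : x ∈ C := by have := hmeet _ hA C hC; grind
  have hpair : ∀ {D}, D ∈ 𝒜 → ∀ {u v}, u ∈ D → v ∈ D → u ≠ v → D = {u, v} := by
    intro D hD u v hu hv huv
    exact (eq_of_subset_of_card_le (by grind) (by rw [htwo D hD, card_pair huv])).symm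
  obtain rfl := hpair hB hyB hzB (by grind)
  obtain rfl := hpair hC hxC hzC (by grind)
  have htriangle : 𝒜 ⊆ {{x, y}, {y, z}, {x, z}} := by
    intro D hD
    have hDA : x ∈ D ∨ y ∈ D := by have := hmeet D hD _ hA; grind
    have hDB : y ∈ D ∨ z ∈ D := by have := hmeet D hD _ hB; grind
    have hDC : x ∈ D ∨ z ∈ D := by have := hmeet D hD _ hC; grind
    grind
  have := (card_le_card htriangle).trans card_le_three
  omega

variable {β : Type*} [DecidableEq β]

theorem eq_of_card_two_of_card_inter {F : Finset α → Finset β}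
    (hF : ∀ A B, #A = 2 → #B = 2 → #(F A ∩ F B) = #(A ∩ B)) {A B : Finset α}
    (hA : #A = 2) (hB : #B = 2) (hAB : F A = F B) : A = B := by
  have hinter : #(A ∩ B) = 2 := by rw [← hF A B hA hB, hAB, hF B B hB hB, inter_self, hB]
  rw [← eq_of_subset_of_card_le inter_subset_left (hA.trans hinter.symm).le]
  exact eq_of_subset_of_card_le inter_subset_right (hB.trans hinter.symm).le

variable [Fintype α]

theorem exists_forall_mem_pair (hα : 5 ≤ Fintype.card α) {F : Finset α → Finset β}
    (hF : ∀ A B, #A = 2 → #B = 2 → #(F A ∩ F B) = #(A ∩ B)) (p : α) :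
    ∃ x, ∀ q, q ≠ p → x ∈ F {p, q} := by
  set 𝒜 : Finset (Finset β) := (univ.erase p).image fun q => F {p, q}
  have hpair : ∀ q ∈ univ.erase p, #{p, q} = 2 := fun q hq => card_pair (ne_of_mem_erase hq).symm
  have hcard : #𝒜 = Fintype.card α - 1 := by
    rw [card_image_of_injOn, card_erase_of_mem (mem_univ p), card_univ]
    intro q hq r hr hqr
    have hqr' := eq_of_card_two_of_card_inter hF (hpair q hq) (hpair r hr) hqr
    have hmem : q ∈ ({p, r} : Finset α) := hqr' ▸ mem_insert_of_mem (mem_singleton_self q)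
    simpa [ne_of_mem_erase hq] using hmem
  have htwo : ∀ A ∈ 𝒜, #A = 2 := by
    rintro A hA
    obtain ⟨q, hq, rfl⟩ := mem_image.1 hA
    simpa only [inter_self, hpair q hq] using hF _ _ (hpair q hq) (hpair q hq)
  have hinter : (𝒜 : Set (Finset β)).Intersecting := by
    intro A hA B hB hdisj
    obtain ⟨q, hq, rfl⟩ := mem_image.1 (mem_coe.1 hA)
    obtain ⟨r, hr, rfl⟩ := mem_image.1 (mem_coe.1 hB)
    have hzero := hF _ _ (hpair q hq) (hpair r hr)
    rw [disjoint_iff_inter_eq_empty.1 hdisj, card_empty, eq_comm, card_eq_zero] at hzero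
    exact notMem_empty p (hzero ▸ by simp)
  obtain ⟨x, hx⟩ := exists_forall_mem_of_intersecting htwo hinter (by omega)
  exact ⟨x, fun q hq => hx _ (mem_image_of_mem _ (mem_erase.2 ⟨hq, mem_univ q⟩))⟩

/-- A form of Whitney's theorem for the line graphs of complete graphs. -/
theorem exists_injective_forall_eq_image (hα : 5 ≤ Fintype.card α) {F : Finset α → Finset β}
    (hF : ∀ A B, #A = 2 → #B = 2 → #(F A ∩ F B) = #(A ∩ B)) :
    ∃ π : α → β, Injective π ∧ ∀ A, #A = 2 → F A = A.image π := by
  choose π hπ using exists_forall_mem_pair hα hF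
  have hinj : Injective π := by
    intro p q hpq
    by_contra hne
    obtain ⟨a, ha⟩ := exists_mem_notMem_of_card_lt_card (s := {p, q}) (t := univ)
      (card_le_two.trans_lt (by rw [card_univ]; omega))
    obtain ⟨b, hb⟩ := exists_mem_notMem_of_card_lt_card (s := {p, q, a}) (t := univ)
      (card_le_three.trans_lt (by rw [card_univ]; omega))
    simp only [mem_univ, mem_insert, mem_singleton, not_or, true_and] at ha hb
    have hdisj : ({p, a} ∩ {q, b} : Finset α) = ∅ := by
      simp [Ne.symm, *]
    have hempty := hF {p, a} {q, b} (card_pair (Ne.symm ha.1)) (card_pair (Ne.symm hb.2.1))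
    rw [hdisj, card_empty, card_eq_zero] at hempty
    exact notMem_empty (π p) (hempty ▸ mem_inter.2 ⟨hπ p a ha.1, hpq ▸ hπ q b hb.2.1⟩)
  refine ⟨π, hinj, fun A hA => (eq_of_subset_of_card_le ?_ ?_).symm⟩
  · obtain ⟨p, q, hpq, rfl⟩ := card_eq_two.1 hA
    rw [image_insert, image_singleton, insert_subset_iff, singleton_subset_iff]
    exact ⟨hπ p q hpq.symm, pair_comm p q ▸ hπ q p hpq⟩
  · rw [card_image_of_injective A hinj, ← inter_self (F A), hF A A hA hA, inter_self]

end SetFamilies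

section Words

theorem zmod_two_eq_zero_or_one (a : ZMod 2) : a = 0 ∨ a = 1 := by decide +revert

theorem hammingDist_comp_equiv {ι κ α : Type*} [Fintype ι] [Fintype κ] [DecidableEq α]
    (x y : ι → α) (e : κ ≃ ι) : hammingDist (x ∘ e) (y ∘ e) = hammingDist x y :=
  card_equiv e fun i => by simp

variable {n : ℕ}

/-- The positions in which the word `x` has the letter `1`. -/
def ones (x : Word n) : Finset (Fin n) := {i | x i ≠ 0}

/-- The word whose letters `1` are in the positions in `S`; the inverse of `ones`. -/
def indicatorWord (S : Finset (Fin n)) : Word n := fun i => if i ∈ S then 1 else 0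

theorem card_ones (x : Word n) : #(ones x) = hammingNorm x := rfl

theorem mem_ones {x : Word n} {i : Fin n} : i ∈ ones x ↔ x i ≠ 0 := by simp [ones]

theorem ones_indicatorWord (S : Finset (Fin n)) : ones (indicatorWord S) = S := by
  ext i
  simp [ones, indicatorWord]

theorem ones_injective : Injective (ones : Word n → Finset (Fin n)) := by
  intro x y hxy
  ext i
  have hi : x i ≠ 0 ↔ y i ≠ 0 := by rw [← mem_ones, ← mem_ones, hxy]
  generalize x i = a at hi
  generalize y i = b at hi
  decide +revert

theorem ones_add (x y : Word n) : ones (x + y) = ones x ∆ ones y := by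
  ext i
  simp only [mem_symmDiff, mem_ones, Pi.add_apply]
  generalize x i = a
  generalize y i = b
  decide +revert

theorem ones_add_one (x : Word n) : ones (x + 1) = (ones x)ᶜ := by
  ext i
  simp only [mem_compl, mem_ones, Pi.add_apply, Pi.one_apply]
  generalize x i = a
  decide +revert

theorem add_self_eq_zero_of_word (x : Word n) : x + x = 0 :=
  funext fun i => CharTwo.add_self_eq_zero (x i)

theorem hammingDist_eq_hammingNorm_add (x y : Word n) : hammingDist x y = hammingNorm (x + y) := by
  rw [hammingDist_eq_hammingNorm]
  congr 1
  linear_combination -add_self_eq_zero_of_word x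

theorem hammingDist_le (x y : Word n) : hammingDist x y ≤ n := by
  simpa using hammingDist_le_card_fintype (x := x) (y := y)

theorem hammingNorm_add_one_add_hammingNorm (x : Word n) :
    hammingNorm (x + 1) + hammingNorm x = n := by
  rw [← card_ones, ← card_ones, ones_add_one, card_compl_add_card, Fintype.card_fin]

theorem hammingDist_add_one_add_hammingDist (x y : Word n) :
    hammingDist x (y + 1) + hammingDist x y = n := by
  rw [hammingDist_eq_hammingNorm_add, hammingDist_eq_hammingNorm_add, ← add_assoc,
    hammingNorm_add_one_add_hammingNorm]

theorem eq_add_one_of_hammingDist_eq {x y : Word n} (h : hammingDist x y = n) : y = x + 1 := by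
  have hdist := hammingDist_add_one_add_hammingDist x y
  have hzero : hammingDist x (y + 1) = 0 := by omega
  rw [hammingDist_eq_zero.1 hzero, add_assoc, add_self_eq_zero_of_word, add_zero]

/-- The number of words at distances `s` and `t` from `x` and `y`. -/
def sphereCount (s t : ℕ) (x y : Word n) : ℕ := #{z | hammingDist x z = s ∧ hammingDist y z = t}

theorem sphereCount_eq_card_finset (s t : ℕ) (x y : Word n) :
    sphereCount s t x y =
      #{S : Finset (Fin n) | #S = s ∧ #(S ∆ ones (x + y)) = t} := by
  refine card_nbij (fun z => ones (x + z)) ?_ ?_ ?_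
  · intro z hz
    have hyz : y + z = x + z + (x + y) := by linear_combination -add_self_eq_zero_of_word x
    simpa [hammingDist_eq_hammingNorm_add, hyz, ← ones_add, card_ones] using hz
  · exact fun z _ w _ hzw => add_left_cancel (ones_injective hzw)
  · intro S hS
    have hx : x + (x + indicatorWord S) = indicatorWord S := by
      linear_combination add_self_eq_zero_of_word x
    have hy : y + (x + indicatorWord S) = indicatorWord S + (x + y) := by ring
    refine ⟨x + indicatorWord S, ?_, by simp only [hx, ones_indicatorWord]⟩
    simpa [hammingDist_eq_hammingNorm_add, hx, hy, ← card_ones, ones_add _ (x + y),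
      ones_indicatorWord] using hS

theorem sphereCount_eq {s t a b : ℕ} {x y : Word n} (hs : s = a + b)
    (ht : t + a = b + hammingDist x y) :
    sphereCount s t x y = (hammingDist x y).choose a * (n - hammingDist x y).choose b := by
  rw [hammingDist_eq_hammingNorm_add, ← card_ones] at ht ⊢
  have hcard := card_filter_card_inter_card_sdiff (ones (x + y)) a b
  rw [Fintype.card_fin] at hcard
  rw [sphereCount_eq_card_finset, ← hcard]
  refine congrArg card (filter_congr fun S _ => ?_)
  have hsymm := card_symmDiff_add_two_mul_card_inter S (ones (x + y))
  have hsplit := card_inter_add_card_sdiff S (ones (x + y))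
  omega

theorem sphereCount_self_eq_zero {s : ℕ} {x y : Word n} (h : Odd (hammingDist x y)) :
    sphereCount s s x y = 0 := by
  rw [sphereCount_eq_card_finset, card_eq_zero, filter_eq_empty_iff]
  rintro S - ⟨hS, hsymm⟩
  have hcard := card_symmDiff_add_two_mul_card_inter S (ones (x + y))
  rw [card_ones, ← hammingDist_eq_hammingNorm_add] at hcard
  grind

theorem two_mul_sphereCount {m a : ℕ} {x y : Word (2 * m + 1)} (h : hammingDist x y = 2 * a) :
    2 * sphereCount m m x y = a.centralBinom * (m + 1 - a).centralBinom := by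
  have hle := hammingDist_le x y
  obtain ⟨b, rfl⟩ := Nat.exists_eq_add_of_le (show a ≤ m by omega)
  rw [sphereCount_eq (a := a) (b := b) rfl (by omega), h,
    show 2 * (a + b) + 1 - 2 * a = 2 * b + 1 by omega, show a + b + 1 - a = b + 1 by omega,
    centralBinom_succ_eq_two_mul_choose, Nat.centralBinom_eq_two_mul_choose]
  ring

theorem sphereCount_two_ne {m : ℕ} (hm : 2 ≤ m) {x y x' y' : Word (2 * m + 1)}
    (h : hammingDist x y = 2) (h' : hammingDist x' y' = 2 * m) :
    sphereCount m (m + 2) x y ≠ sphereCount m (m + 2) x' y' := by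
  obtain ⟨k, rfl⟩ := Nat.exists_eq_add_of_le' hm
  have hcount : sphereCount (k + 2) (k + 2 + 2) x y = (2 * k + 3).choose (k + 1) := by
    rw [sphereCount_eq (a := 0) (b := k + 2) (by omega) (by omega), h, Nat.choose_zero_right,
      one_mul, show 2 * (k + 2) + 1 - 2 = 2 * k + 3 by omega]
    exact Nat.choose_symm_of_eq_add (by omega)
  have hcount' : sphereCount (k + 2) (k + 2 + 2) x' y' = (2 * k + 4).choose (k + 1) := by
    rw [sphereCount_eq (a := k + 1) (b := 1) (by omega) (by omega), h', Nat.choose_one_right,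
      show 2 * (k + 2) + 1 - 2 * (k + 2) = 1 by omega, mul_one,
      show 2 * (k + 2) = 2 * k + 4 by ring]
  have hpos : 0 < (2 * k + 3).choose k := Nat.choose_pos (by omega)
  rw [hcount, hcount', Nat.choose_succ_succ' (2 * k + 3) k]
  omega

end Words

section DistancePreserving

variable {n : ℕ} {φ : Word n → Word n}

/-- `φ` preserves and reflects the distance `p`. -/
def PreservesDist (φ : Word n → Word n) (p : ℕ) : Prop :=
  ∀ x y, hammingDist (φ x) (φ y) = p ↔ hammingDist x y = p

theorem preservesDist_of_injective (hφ : Injective φ) {p : ℕ}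
    (h : ∀ x y, hammingDist x y = p → hammingDist (φ x) (φ y) = p) : PreservesDist φ p := by
  let pairs : Finset (Word n × Word n) := {q | hammingDist q.1 q.2 = p}
  have hmaps : Set.MapsTo (Prod.map φ φ) pairs pairs := by
    intro q hq
    simpa [pairs] using h _ _ (by simpa [pairs] using hq)
  have hsurj := surjOn_of_injOn_of_card_le _ hmaps (hφ.prodMap hφ).injOn le_rfl
  refine fun x y => ⟨fun hxy => ?_, h x y⟩
  obtain ⟨q, hq, hqxy⟩ := hsurj (show (φ x, φ y) ∈ (pairs : Set _) by simpa [pairs] using hxy)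
  obtain rfl : q = (x, y) := (hφ.prodMap hφ) hqxy
  simpa [pairs] using hq

theorem IsWeakIsometry.preservesDist {P : Set ℕ} (h : IsWeakIsometry P φ) {p : ℕ} (hp : p ∈ P) :
    PreservesDist φ p :=
  preservesDist_of_injective h.1.injective (h.2 p hp)

theorem sphereCount_map {s t : ℕ} (hφ : Bijective φ) (hs : PreservesDist φ s)
    (ht : PreservesDist φ t) (x y : Word n) :
    sphereCount s t (φ x) (φ y) = sphereCount s t x y :=
  (card_bijective φ hφ fun z => by simp [hs x z, ht y z]).symm

theorem map_add_one (h : PreservesDist φ n) (x : Word n) : φ (x + 1) = φ x + 1 := by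
  refine eq_add_one_of_hammingDist_eq ((h _ _).2 ?_)
  simpa using hammingDist_add_one_add_hammingDist x x

theorem hammingDist_map_le (h : ∀ x y, hammingDist x y = 1 → hammingDist (φ x) (φ y) = 1)
    (x y : Word n) : hammingDist (φ x) (φ y) ≤ hammingDist x y := by
  induction hk : hammingDist x y generalizing x with
  | zero => simp [hammingDist_eq_zero.1 hk]
  | succ k ih =>
    rw [hammingDist_eq_hammingNorm_add, ← card_ones] at hk
    obtain ⟨i, hi⟩ := card_pos.1 (by omega : 0 < #(ones (x + y)))
    set z := x + indicatorWord {i} with hz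
    have hxz : hammingDist x z = 1 := by
      rw [hammingDist_eq_hammingNorm_add, hz, ← add_assoc, add_self_eq_zero_of_word, zero_add,
        ← card_ones, ones_indicatorWord, card_singleton]
    have hzy : hammingDist z y = k := by
      rw [hammingDist_eq_hammingNorm_add, hz, add_right_comm, ← card_ones, ones_add,
        ones_indicatorWord]
      have hcard := card_symmDiff_add_two_mul_card_inter (ones (x + y)) {i}
      rw [inter_singleton_of_mem hi, card_singleton] at hcard
      omega
    calc hammingDist (φ x) (φ y) ≤ hammingDist (φ x) (φ z) + hammingDist (φ z) (φ y) :=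
          hammingDist_triangle _ _ _
      _ ≤ 1 + k := add_le_add (h x z hxz).le (ih z hzy)
      _ = k + 1 := add_comm 1 k

theorem isCubeIsometry_of_preservesDist_one (hφ : Bijective φ) (h : PreservesDist φ 1) :
    IsCubeIsometry φ := by
  refine ⟨hφ, fun x y => le_antisymm (hammingDist_map_le (fun a b => (h a b).2) x y) ?_⟩
  obtain ⟨ψ, hψφ, hφψ⟩ := bijective_iff_has_inverse.1 hφ
  have hψ := hammingDist_map_le (φ := ψ) (fun a b hab => by rwa [← h, hφψ, hφψ]) (φ x) (φ y)
  rwa [hψφ, hψφ] at hψ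

end DistancePreserving

section FoldedDistance

variable {n m : ℕ}

/-- The distance of `x` and `y` in the folded cube, whose elements are the pairs of complementary
words of length `n + 1`: extending `x` and `y` by the same letter gives words at distance
`hammingDist x y`, and complementing one of them gives the other term of the minimum. -/
def foldedDist (x y : Word n) : ℕ := min (hammingDist x y) (n + 1 - hammingDist x y)

theorem foldedDist_map {φ : Word (2 * m + 1) → Word (2 * m + 1)} (hφ : Bijective φ)
    (hm : PreservesDist φ m) {x y : Word (2 * m + 1)} (heven : Even (hammingDist x y)) :
    foldedDist (φ x) (φ y) = foldedDist x y := by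
  obtain ⟨a, ha⟩ := even_iff_exists_two_mul.1 heven
  have hcount := two_mul_sphereCount ha
  rw [← sphereCount_map hφ hm hm] at hcount
  have hle := hammingDist_le x y
  have hle' := hammingDist_le (φ x) (φ y)
  rcases Nat.even_or_odd' (hammingDist (φ x) (φ y)) with ⟨b, hb | hb⟩
  · rw [two_mul_sphereCount hb] at hcount
    have := eq_or_eq_of_centralBinom_mul_eq (by omega) hcount
    simp only [foldedDist, ha, hb]
    omega
  · rw [sphereCount_self_eq_zero ⟨b, hb⟩, mul_zero, eq_comm, mul_eq_zero] at hcount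
    simp [Nat.centralBinom_ne_zero] at hcount

theorem preservesDist_add_two (heven : Even m) {φ : Word (2 * m + 1) → Word (2 * m + 1)}
    (hφ : Bijective φ) (hm : PreservesDist φ m) : PreservesDist φ (m + 2) := by
  refine preservesDist_of_injective hφ.injective fun x y hxy => ?_
  -- The folded distance is `m` exactly at the Hamming distances `m` and `m + 2`.
  have hfolded := foldedDist_map hφ hm (x := x) (y := y) (by rw [hxy]; exact heven.add even_two)
  have hiff := hm x y
  have hle := hammingDist_le (φ x) (φ y)
  have hle' := hammingDist_le x y
  simp only [foldedDist] at hfolded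
  omega

theorem preservesDist_one_of_even (heven : Even m) {φ : Word (2 * m + 1) → Word (2 * m + 1)}
    (hφ : Bijective φ) (hm : PreservesDist φ m) (hn : PreservesDist φ (2 * m + 1)) :
    PreservesDist φ 1 := by
  rcases Nat.eq_zero_or_pos m with rfl | hpos
  · exact hn
  have htwo : 2 ≤ m := by grind
  refine preservesDist_of_injective hφ.injective fun x y hxy => ?_
  have hadd := hammingDist_add_one_add_hammingDist x y
  have hadd' := hammingDist_add_one_add_hammingDist (φ x) (φ y)
  rw [← map_add_one hn] at hadd'
  have hcount := sphereCount_map hφ hm (preservesDist_add_two heven hφ hm) x (y + 1)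
  have hne : hammingDist (φ x) (φ (y + 1)) ≠ 2 := fun h =>
    sphereCount_two_ne htwo h (by omega) hcount
  have hfolded := foldedDist_map hφ hm (x := x) (y := y + 1) (by grind)
  simp only [foldedDist] at hfolded
  omega

theorem isCubeIsometry_of_even (heven : Even m) {φ : Word (2 * m + 1) → Word (2 * m + 1)}
    (hφ : Bijective φ) (hm : PreservesDist φ m) (hn : PreservesDist φ (2 * m + 1)) :
    IsCubeIsometry φ :=
  isCubeIsometry_of_preservesDist_one hφ (preservesDist_one_of_even heven hφ hm hn)

end FoldedDistance

section FoldedCube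

variable {n : ℕ}

/-- The word of length `n` represented by the word of length `n + 1` with letters `1` in the
positions in `S`. The position `none` is the extra one, and complementary words of length `n + 1`
represent the same word. -/
def foldedWord (S : Finset (Option (Fin n))) : Word n :=
  fun i => (if none ∈ S then 1 else 0) + if some i ∈ S then 1 else 0

theorem foldedWord_empty : foldedWord (∅ : Finset (Option (Fin n))) = 0 := by
  ext i
  simp [foldedWord]

theorem foldedWord_symmDiff (S T : Finset (Option (Fin n))) :
    foldedWord (S ∆ T) = foldedWord S + foldedWord T := by
  ext i
  simp only [foldedWord, mem_symmDiff, Pi.add_apply]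
  split_ifs <;> first | rfl | tauto

theorem foldedWord_compl (S : Finset (Option (Fin n))) : foldedWord Sᶜ = foldedWord S := by
  ext i
  simp only [foldedWord, mem_compl]
  split_ifs <;> rfl

theorem foldedWord_map_some_ones (x : Word n) :
    foldedWord ((ones x).map Embedding.some) = x := by
  ext i
  simp only [foldedWord, mem_map, Embedding.some_apply, reduceCtorEq, and_false, exists_false,
    if_false, zero_add, Option.some.injEq, exists_eq_right, mem_ones]
  generalize x i = a
  decide +revert

/-- The representative of `x` of length `n + 1` with letter `0` in the extra position. -/
def extendByZero (x : Word n) (p : Option (Fin n)) : ZMod 2 := p.elim 0 x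

theorem extendByZero_none (x : Word n) : extendByZero x none = 0 := rfl

theorem extendByZero_some (x : Word n) (i : Fin n) : extendByZero x (some i) = x i := rfl

theorem mem_map_some_ones {x : Word n} {p : Option (Fin n)} :
    p ∈ (ones x).map Embedding.some ↔ extendByZero x p ≠ 0 := by
  cases p <;> simp [mem_ones, extendByZero_none, extendByZero_some]

theorem ones_foldedWord (S : Finset (Option (Fin n))) :
    ones (foldedWord S) = if none ∈ S then (eraseNone S)ᶜ else eraseNone S := by
  ext i
  by_cases hnone : none ∈ S <;> by_cases hi : some i ∈ S <;>
    simp [mem_ones, foldedWord, hnone, hi, CharTwo.add_self_eq_zero]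

theorem card_finset_option_fin_le (S : Finset (Option (Fin n))) : #S ≤ n + 1 := by
  simpa using card_le_univ S

theorem hammingNorm_foldedWord (S : Finset (Option (Fin n))) :
    hammingNorm (foldedWord S) = if none ∈ S then n + 1 - #S else #S := by
  rw [← card_ones, ones_foldedWord]
  split_ifs with h
  · rw [card_compl, Fintype.card_fin, card_eraseNone_of_mem h]
    have := card_pos.2 ⟨_, h⟩
    omega
  · exact card_eraseNone_of_not_mem h

theorem hammingDist_foldedWord (S T : Finset (Option (Fin n))) :
    hammingDist (foldedWord S) (foldedWord T) =
      if none ∈ S ∆ T then n + 1 - #(S ∆ T) else #(S ∆ T) := by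
  rw [hammingDist_eq_hammingNorm_add, ← foldedWord_symmDiff, hammingNorm_foldedWord]

theorem foldedDist_foldedWord (S T : Finset (Option (Fin n))) :
    foldedDist (foldedWord S) (foldedWord T) = min #(S ∆ T) (n + 1 - #(S ∆ T)) := by
  have hle := card_finset_option_fin_le (S ∆ T)
  rw [foldedDist, hammingDist_foldedWord]
  split_ifs <;> omega

theorem even_hammingDist_foldedWord (hn : Odd n) (S T : Finset (Option (Fin n))) :
    Even (hammingDist (foldedWord S) (foldedWord T)) ↔ Even #(S ∆ T) := by
  have hle := card_finset_option_fin_le (S ∆ T)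
  rw [hammingDist_foldedWord]
  split_ifs
  · rw [Nat.even_sub hle]
    simp [hn.add_one]
  · rfl

theorem exists_card_eq_foldedDist (x : Word n) :
    ∃ S, #S = foldedDist 0 x ∧ foldedWord S = x := by
  set S := (ones x).map Embedding.some with hS
  have hx : foldedWord S = x := foldedWord_map_some_ones x
  have hcard : #S = hammingDist 0 x := by
    rw [hS, card_map, card_ones, hammingDist_zero_left]
  rcases le_total (hammingDist 0 x) (n + 1 - hammingDist 0 x) with h | h
  · exact ⟨S, by rw [hcard, foldedDist, min_eq_left h], hx⟩
  · refine ⟨Sᶜ, ?_, by rw [foldedWord_compl, hx]⟩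
    rw [card_compl, Fintype.card_option, Fintype.card_fin, hcard, foldedDist, min_eq_right h]

theorem foldedDist_pair_eq_iff (hn : n % 4 = 3) {S : Finset (Option (Fin n))} (hS : Even #S)
    {p q : Option (Fin n)} (hpq : p ≠ q) :
    foldedDist (foldedWord S) (foldedWord {p, q}) = foldedDist (foldedWord S) 0 ↔
      ¬(p ∈ S ↔ q ∈ S) := by
  have hinter : #(S ∩ {p, q}) = (if p ∈ S then 1 else 0) + if q ∈ S then 1 else 0 := by
    rw [inter_comm, ← filter_mem_eq_inter, card_filter, sum_pair hpq]
  have hcard := card_symmDiff_add_two_mul_card_inter S {p, q}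
  rw [card_pair hpq, hinter] at hcard
  have hle := card_finset_option_fin_le (S ∆ {p, q})
  have hle' := card_finset_option_fin_le S
  rw [← foldedWord_empty, foldedDist_foldedWord, foldedDist_foldedWord, ← bot_eq_empty,
    symmDiff_bot]
  -- If the cardinality changes by `2`, the folded distance stays the same only for
  -- `#S + #(S ∆ {p, q}) = n + 1`, which fails modulo `4`.
  obtain ⟨k, hk⟩ := hS
  by_cases hp : p ∈ S <;> by_cases hq : q ∈ S <;>
    simp only [hp, hq, if_true, if_false, iff_self, iff_true, iff_false, not_true,
      not_false_iff] at hcard ⊢ <;>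
    omega

theorem foldedDist_pair_eq_iff_extendByZero_ne (hn : n % 4 = 3) {x : Word n}
    (hx : Even (hammingNorm x)) {p q : Option (Fin n)} (hpq : p ≠ q) :
    foldedDist x (foldedWord {p, q}) = foldedDist x 0 ↔ extendByZero x p ≠ extendByZero x q := by
  have hiff := foldedDist_pair_eq_iff hn (S := (ones x).map Embedding.some)
    (by rwa [card_map, card_ones]) hpq
  rw [foldedWord_map_some_ones, mem_map_some_ones, mem_map_some_ones] at hiff
  rw [hiff]
  generalize extendByZero x p = a
  generalize extendByZero x q = b
  decide +revert

/-- `φ` preserves the folded distance of words at even Hamming distance, which is what the sphere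
counts of a weak isometry control. -/
def PreservesEvenFoldedDist (φ : Word n → Word n) : Prop :=
  ∀ x y, Even (hammingDist x y) → foldedDist (φ x) (φ y) = foldedDist x y

theorem exists_perm_map_foldedWord (hn : Odd n) (hlarge : 7 ≤ n) {φ : Word n → Word n}
    (hφ : PreservesEvenFoldedDist φ) (hzero : φ 0 = 0) :
    ∃ π : Equiv.Perm (Option (Fin n)),
      ∀ A, #A = 2 → φ (foldedWord A) = foldedWord (A.image π) := by
  have hlift : ∀ A : Finset (Option (Fin n)), #A = 2 →
      ∃ B : Finset (Option (Fin n)), #B = 2 ∧ foldedWord B = φ (foldedWord A) := by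
    intro A hA
    obtain ⟨B, hB, hBA⟩ := exists_card_eq_foldedDist (φ (foldedWord A))
    refine ⟨B, ?_, hBA⟩
    have hsymm : #(∅ ∆ A) = 2 := by rwa [← bot_eq_empty, bot_symmDiff]
    have heven := (even_hammingDist_foldedWord hn ∅ A).2 (by rw [hsymm]; exact even_two)
    rw [hB, ← hzero, ← foldedWord_empty, hφ _ _ heven, foldedDist_foldedWord, hsymm]
    omega
  choose! F hFcard hF using hlift
  have hinter : ∀ A B, #A = 2 → #B = 2 → #(F A ∩ F B) = #(A ∩ B) := by
    intro A B hA hB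
    have hcard := card_symmDiff_add_two_mul_card_inter A B
    have hcard' := card_symmDiff_add_two_mul_card_inter (F A) (F B)
    rw [hFcard A hA, hFcard B hB] at hcard'
    have hfolded := hφ _ _ ((even_hammingDist_foldedWord hn A B).2 (by grind))
    rw [← hF A hA, ← hF B hB, foldedDist_foldedWord, foldedDist_foldedWord] at hfolded
    omega
  obtain ⟨π, hπ, hFπ⟩ := exists_injective_forall_eq_image
    (by rw [Fintype.card_option, Fintype.card_fin]; omega) hinter
  refine ⟨Equiv.ofBijective π (Finite.injective_iff_bijective.1 hπ), fun A hA => ?_⟩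
  rw [← hF A hA, hFπ A hA]
  rfl

theorem even_hammingNorm_map (hn : Odd n) {φ : Word n → Word n} (hφ : PreservesEvenFoldedDist φ)
    (hzero : φ 0 = 0) {x : Word n} (hx : Even (hammingNorm x)) : Even (hammingNorm (φ x)) := by
  have hfolded := hφ x 0 (by rwa [hammingDist_zero_right])
  have hle := hammingDist_le (φ x) 0
  have hle' := hammingDist_le x 0
  simp only [hzero, foldedDist, hammingDist_zero_right] at hfolded hle hle'
  grind

theorem extendByZero_map_perm (hn : n % 4 = 3) {φ : Word n → Word n}
    (hφ : PreservesEvenFoldedDist φ) (hzero : φ 0 = 0) {π : Equiv.Perm (Option (Fin n))}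
    (hπ : ∀ A, #A = 2 → φ (foldedWord A) = foldedWord (A.image π))
    {x : Word n} (hx : Even (hammingNorm x)) (p : Option (Fin n)) :
    extendByZero (φ x) (π p) = extendByZero x p + extendByZero x (π.symm none) := by
  have hxzero := hφ x 0 (by rwa [hammingDist_zero_right])
  have hx' := even_hammingNorm_map (Nat.odd_iff.2 (by omega)) hφ hzero hx
  rcases eq_or_ne p (π.symm none) with rfl | hpq
  · rw [π.apply_symm_apply]
    exact (CharTwo.add_self_eq_zero _).symm
  have hpair : #{p, π.symm none} = 2 := card_pair hpq
  have heven : Even (hammingDist x (foldedWord {p, π.symm none})) := by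
    have hcard := card_symmDiff_add_two_mul_card_inter ((ones x).map Embedding.some)
      {p, π.symm none}
    rw [card_map, card_ones, hpair] at hcard
    rw [← foldedWord_map_some_ones x, even_hammingDist_foldedWord (Nat.odd_iff.2 (by omega))]
    grind
  have hiff := foldedDist_pair_eq_iff_extendByZero_ne hn hx' (p := π p) (q := none) (by grind)
  have himage : ({p, π.symm none} : Finset _).image π = {π p, none} := by simp [image_insert]
  rw [← himage, ← hπ _ hpair, ← hzero, hxzero, hφ _ _ heven,
    foldedDist_pair_eq_iff_extendByZero_ne hn hx hpq, extendByZero_none] at hiff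
  generalize extendByZero (φ x) (π p) = a at *
  generalize extendByZero x p = b at *
  generalize extendByZero x (π.symm none) = c at *
  clear * - hiff
  decide +revert

end FoldedCube

section SigmaMapping

variable {n : ℕ}

theorem onesExcept_comp (e : Equiv.Perm (Fin n)) (i : Fin n) :
    onesExcept (e i) ∘ e = onesExcept i := by
  ext k
  simp [onesExcept]

theorem onesExcept_eq_add_one (i : Fin n) : onesExcept i = indicatorWord {i} + 1 := by
  ext k
  simp only [onesExcept, indicatorWord, Pi.add_apply, Pi.one_apply, mem_singleton]
  split_ifs <;> rfl

theorem isSigmaMapping_iff {i j : Fin n} {τ : Word n → Word n} :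
    IsSigmaMapping i j τ ↔
      ∃ e : Equiv.Perm (Fin n), e i = j ∧ ∀ c, τ c ∘ e = c + c i • onesExcept i := by
  constructor
  · rintro ⟨σ, hσ⟩
    have hj : σ.extendSubtype i = j := not_not.1 (σ.extendSubtype_not_mem i (by simp))
    refine ⟨σ.extendSubtype, hj, fun c => funext fun k => ?_⟩
    by_cases hk : k = i
    · subst hk
      rcases zmod_two_eq_zero_or_one (c k) with hc | hc
      · simp [hj, ((hσ c).1 hc).2, hc]
      · simp [onesExcept, hj, ((hσ c).2 hc).2, hc]
    · have happ := σ.extendSubtype_apply_of_mem k hk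
      rcases zmod_two_eq_zero_or_one (c i) with hc | hc
      · simp [happ, ((hσ c).1 hc).1, hc]
      · simp [onesExcept, hk, happ, ((hσ c).2 hc).1, hc]
  · rintro ⟨e, rfl, he⟩
    have hτ : ∀ c k, τ c k = c (e.symm k) + c i * onesExcept i (e.symm k) := fun c k => by
      simpa using congrFun (he c) (e.symm k)
    refine ⟨e.subtypeEquiv fun k => by simp, fun c => ⟨fun hc => ⟨fun k => ?_, ?_⟩,
      fun hc => ⟨fun k => ?_, ?_⟩⟩⟩
    · simp [hτ, hc]
    · simp [hτ, hc]
    · have hk : e.symm k ≠ i := fun h => k.2 (e.symm_apply_eq.1 h)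
      simp [hτ, hc, onesExcept, hk]
    · simp [hτ, hc, onesExcept]

/-- The twisted mapping of positions `i = j` and trivial `σ`: all letters of `c` outside position
`i` are changed if `c i` differs from the parity of the weight of `c`, which is the sum of its
letters. -/
def twist (i : Fin n) (c : Word n) : Word n := c + (c i + ∑ k, c k) • onesExcept i

theorem sum_eq_hammingNorm (c : Word n) : ∑ k, c k = hammingNorm c := by
  rw [hammingNorm, card_filter, Nat.cast_sum]
  refine sum_congr rfl fun k _ => ?_
  generalize c k = a
  decide +revert

theorem twist_of_even (i : Fin n) {c : Word n} (hc : Even (hammingNorm c)) :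
    twist i c = c + c i • onesExcept i := by
  rw [twist, sum_eq_hammingNorm, hc.natCast_zmod_two, add_zero]

theorem twist_of_odd (i : Fin n) {c : Word n} (hc : Odd (hammingNorm c)) :
    twist i c = c + (c i + 1) • onesExcept i := by
  rw [twist, sum_eq_hammingNorm, hc.natCast_zmod_two]

theorem twist_add (i : Fin n) (x y : Word n) : twist i (x + y) = twist i x + twist i y := by
  simp only [twist, Pi.add_apply, sum_add_distrib, add_smul]
  ring

theorem isTwistedSigmaMapping_iff {φ : Word n → Word n} :
    IsTwistedSigmaMapping φ ↔ ∃ (e : Equiv.Perm (Fin n)) (i : Fin n), ∀ c, φ c ∘ e = twist i c := by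
  constructor
  · rintro ⟨i, j, τ, hτ, heven, hodd⟩
    obtain ⟨e, rfl, he⟩ := isSigmaMapping_iff.1 hτ
    refine ⟨e, i, fun c => ?_⟩
    rcases Nat.even_or_odd (hammingNorm c) with hc | hc
    · rw [heven c hc, he, twist_of_even i hc]
    · rw [hodd c hc, twist_of_odd i hc, add_smul, one_smul, ← add_assoc, ← he]
      conv_rhs => rw [← onesExcept_comp e]
      rfl
  · rintro ⟨e, i, he⟩
    have hφ : ∀ c, φ c = twist i c ∘ e.symm := fun c => by
      rw [← he, comp_assoc, e.self_comp_symm, comp_id]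
    refine ⟨i, e i, fun c => (c + c i • onesExcept i) ∘ e.symm,
      isSigmaMapping_iff.2 ⟨e, rfl, fun c => ?_⟩, fun c hc => ?_, fun c hc => ?_⟩
    · rw [comp_assoc, e.symm_comp_self, comp_id]
    · rw [hφ, twist_of_even i hc]
    · rw [hφ, twist_of_odd i hc, add_smul, one_smul, ← add_assoc, ← onesExcept_comp e]
      ext k
      simp [translation]

theorem hammingNorm_add_indicatorWord_singleton (c : Word n) (i : Fin n) :
    hammingNorm (c + indicatorWord {i}) + (if c i = 0 then 0 else 2) = hammingNorm c + 1 := by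
  have hcard := card_symmDiff_add_two_mul_card_inter (ones c) {i}
  rw [← card_ones, ← card_ones, ones_add, ones_indicatorWord, ← card_singleton i, ← hcard]
  split_ifs with hi <;> simp [mem_ones, hi]

theorem hammingNorm_twist (i : Fin n) (c : Word n) :
    hammingNorm (twist i c) = hammingNorm c ∨
      Odd (hammingNorm c) ∧ hammingNorm (twist i c) + hammingNorm c = n - 1 ∨
      Even (hammingNorm c) ∧ hammingNorm (twist i c) + hammingNorm c = n + 1 := by
  have hflip := hammingNorm_add_one_add_hammingNorm (c + indicatorWord {i})
  rw [add_assoc, ← onesExcept_eq_add_one] at hflip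
  have hsingle := hammingNorm_add_indicatorWord_singleton c i
  rcases Nat.even_or_odd (hammingNorm c) with hc | hc <;>
    rcases zmod_two_eq_zero_or_one (c i) with hi | hi
  · left
    rw [twist_of_even i hc, hi, zero_smul, add_zero]
  · rw [twist_of_even i hc, hi, one_smul]
    rw [hi, if_neg one_ne_zero] at hsingle
    exact Or.inr (Or.inr ⟨hc, by omega⟩)
  · rw [twist_of_odd i hc, hi, zero_add, one_smul]
    rw [hi, if_pos rfl] at hsingle
    exact Or.inr (Or.inl ⟨hc, by omega⟩)
  · left
    rw [twist_of_odd i hc, hi, CharTwo.add_self_eq_zero, zero_smul, add_zero]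

theorem isWeakIsometry_of_comp_eq_twist (hn : n % 4 = 3) {φ : Word n → Word n}
    {e : Equiv.Perm (Fin n)} {i : Fin n} (hφ : ∀ c, φ c ∘ e = twist i c) :
    IsWeakIsometry {(n - 1) / 2, (n + 1) / 2, n} φ := by
  have hdist : ∀ x y, hammingDist (φ x) (φ y) = hammingNorm (twist i (x + y)) := fun x y => by
    rw [← hammingDist_comp_equiv _ _ e, hφ, hφ, hammingDist_eq_hammingNorm_add, twist_add]
  have hpreserves : ∀ p ∈ ({0, (n - 1) / 2, (n + 1) / 2, n} : Set ℕ), ∀ x y,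
      hammingDist (φ x) (φ y) = p ↔ hammingDist x y = p := by
    intro p hp x y
    have htwist := hammingNorm_twist i (x + y)
    rw [← hdist, ← hammingDist_eq_hammingNorm_add] at htwist
    have hle := hammingDist_le x y
    have hle' := hammingDist_le (φ x) (φ y)
    simp only [Set.mem_insert_iff, Set.mem_singleton_iff, Nat.odd_iff, Nat.even_iff] at hp htwist
    omega
  refine ⟨Finite.injective_iff_bijective.1 fun x y hxy => ?_, fun p hp x y =>
    (hpreserves p (Or.inr hp) x y).2⟩
  rw [← hammingDist_eq_zero, ← hpreserves 0 (by simp), hxy, hammingDist_self]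

theorem map_zero_of_comp_eq_twist {φ : Word n → Word n} {e : Equiv.Perm (Fin n)} {i : Fin n}
    (hφ : ∀ c, φ c ∘ e = twist i c) : φ 0 = 0 := by
  rw [← hammingDist_eq_zero, ← hammingDist_comp_equiv _ _ e, hφ]
  simp [twist]

end SigmaMapping

section NormalForm

variable {n : ℕ}

theorem twist_one (hn : Odd n) (i : Fin n) : twist i (1 : Word n) = 1 := by
  have hsum : (1 : ZMod 2) + n = 0 := by
    rw [hn.natCast_zmod_two, CharTwo.add_self_eq_zero]
  simp [twist, hsum]

theorem eq_of_map_add_one_of_even (hn : Odd n) {f g : Word n → Word n}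
    (hf : ∀ x, f (x + 1) = f x + 1) (hg : ∀ x, g (x + 1) = g x + 1)
    (heven : ∀ x, Even (hammingNorm x) → f x = g x) (x : Word n) : f x = g x := by
  rcases Nat.even_or_odd (hammingNorm x) with hx | hx
  · exact heven x hx
  · have hnorm := hammingNorm_add_one_add_hammingNorm x
    have hx' : f (x + 1) = g (x + 1) := heven _ (by grind)
    rwa [hf, hg, add_left_inj] at hx'

theorem comp_removeNone_of_fix {φ : Word n → Word n} {π : Equiv.Perm (Option (Fin n))}
    (hnone : π none = none) {x : Word n}
    (hπ : ∀ p, extendByZero (φ x) (π p) = extendByZero x p + extendByZero x (π.symm none)) :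
    φ x ∘ Equiv.removeNone π = x := by
  ext k
  obtain ⟨l, hl⟩ := Option.ne_none_iff_exists'.1
    (fun h => by simpa using π.injective (h.trans hnone.symm) : π (some k) ≠ none)
  have hk := hπ (some k)
  rw [← Equiv.removeNone_some π ⟨l, hl⟩, π.symm_apply_eq.2 hnone.symm] at hk
  simpa only [comp_apply, extendByZero_some, extendByZero_none, add_zero] using hk

theorem comp_removeNone_of_map_some {φ : Word n → Word n} {π : Equiv.Perm (Option (Fin n))}
    {i : Fin n} (hi : π (some i) = none) {x : Word n}
    (hπ : ∀ p, extendByZero (φ x) (π p) = extendByZero x p + extendByZero x (π.symm none)) :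
    φ x ∘ Equiv.removeNone π = x + x i • onesExcept i := by
  rw [π.symm_apply_eq.2 hi.symm] at hπ
  ext k
  by_cases hk : k = i
  · subst hk
    have hnone := hπ none
    rw [← Equiv.removeNone_none π hi] at hnone
    simpa [onesExcept, extendByZero_some, extendByZero_none] using hnone
  · obtain ⟨l, hl⟩ := Option.ne_none_iff_exists'.1
      (fun h => hk (by simpa using π.injective (h.trans hi.symm)) : π (some k) ≠ none)
    have hsome := hπ (some k)
    rw [← Equiv.removeNone_some π ⟨l, hl⟩] at hsome
    simpa [onesExcept, extendByZero_some, hk] using hsome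

theorem exists_comp_eq_self_or_twist (hn : n % 4 = 3) (hlarge : 7 ≤ n) {φ : Word n → Word n}
    (hφ : PreservesEvenFoldedDist φ) (hzero : φ 0 = 0) (hone : ∀ x, φ (x + 1) = φ x + 1) :
    ∃ e : Equiv.Perm (Fin n), (∀ x, φ x ∘ e = x) ∨ ∃ i, ∀ x, φ x ∘ e = twist i x := by
  have hodd : Odd n := Nat.odd_iff.2 (by omega)
  obtain ⟨π, hπ⟩ := exists_perm_map_foldedWord hodd hlarge hφ hzero
  have hcomp : ∀ x, φ (x + 1) ∘ Equiv.removeNone π = φ x ∘ Equiv.removeNone π + 1 := fun x => by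
    rw [hone]
    rfl
  refine ⟨Equiv.removeNone π, ?_⟩
  rcases hnone : π.symm none with _ | i
  · left
    refine eq_of_map_add_one_of_even (g := id) hodd hcomp (fun _ => rfl) fun x hx => ?_
    exact comp_removeNone_of_fix (π.symm_apply_eq.1 hnone).symm
      (extendByZero_map_perm hn hφ hzero hπ hx)
  · refine Or.inr ⟨i, eq_of_map_add_one_of_even hodd hcomp (fun x => ?_) fun x hx => ?_⟩
    · rw [twist_add, twist_one hodd]
    · rw [twist_of_even i hx]
      exact comp_removeNone_of_map_some (π.symm_apply_eq.1 hnone).symm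
        (extendByZero_map_perm hn hφ hzero hπ hx)

theorem isCubeIsometry_of_comp_eq_self {φ : Word n → Word n} (hφ : Bijective φ)
    {e : Equiv.Perm (Fin n)} (he : ∀ x, φ x ∘ e = x) : IsCubeIsometry φ :=
  ⟨hφ, fun x y => by rw [← hammingDist_comp_equiv _ _ e, he, he]⟩

theorem isTwistedSigmaMapping_of_odd {m : ℕ} (hm : Odd m) {φ : Word (2 * m + 1) → Word (2 * m + 1)}
    (hφ : Bijective φ) (hpres : PreservesDist φ m) (hpres' : PreservesDist φ (2 * m + 1))
    (hzero : φ 0 = 0) (hiso : ¬IsCubeIsometry φ) : IsTwistedSigmaMapping φ := by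
  obtain rfl | hlarge : m = 1 ∨ 3 ≤ m := by grind
  · exact absurd (isCubeIsometry_of_preservesDist_one hφ hpres) hiso
  obtain ⟨e, he | ⟨i, hi⟩⟩ := exists_comp_eq_self_or_twist (by grind) (by omega)
    (fun x y => foldedDist_map hφ hpres) hzero (map_add_one hpres')
  · exact absurd (isCubeIsometry_of_comp_eq_self hφ he) hiso
  · exact isTwistedSigmaMapping_iff.2 ⟨e, i, hi⟩

end NormalForm

theorem mainTheorem2 (n : ℕ) :
    (n ≡ 1 [MOD 4] → ∀ φ : Word n → Word n,
      IsWeakIsometry {(n - 1) / 2, (n + 1) / 2, n} φ → φ 0 = 0 → IsCubeIsometry φ) ∧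
    (n ≡ 3 [MOD 4] →
      (∀ φ : Word n → Word n,
        IsWeakIsometry {(n - 1) / 2, (n + 1) / 2, n} φ → φ 0 = 0 → ¬ IsCubeIsometry φ →
          IsTwistedSigmaMapping φ) ∧
      (∀ φ : Word n → Word n, IsTwistedSigmaMapping φ →
        IsWeakIsometry {(n - 1) / 2, (n + 1) / 2, n} φ ∧ φ 0 = 0)) := by
  rcases Nat.even_or_odd' n with ⟨m, rfl | rfl⟩
  · constructor <;> intro hn <;> simp only [Nat.ModEq] at hn <;> omega
  refine ⟨fun hn φ hφ _ => ?_, fun hn => ⟨fun φ hφ => ?_, fun φ hφ => ?_⟩⟩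
  · exact isCubeIsometry_of_even (by grind [Nat.ModEq]) hφ.1
      (hφ.preservesDist (by simp)) (hφ.preservesDist (by simp))
  · exact isTwistedSigmaMapping_of_odd (by grind [Nat.ModEq]) hφ.1
      (hφ.preservesDist (by simp)) (hφ.preservesDist (by simp))
  · obtain ⟨e, i, he⟩ := isTwistedSigmaMapping_iff.1 hφ
    exact ⟨isWeakIsometry_of_comp_eq_twist hn he, map_zero_of_comp_eq_twist he⟩
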